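/- Let $n$ qumodes be given, with state space $L^2(\mathbb{R}^n)$ (position representation), quadrature operators $\hat q_j$ (multiplication by $q_j$) and $\hat p_j=-i\,\partial/\partial q_j$, and $\hat a_j=\tfrac1{\sqrt2}(\hat q_j+i\hat p_j)$, $\hat a_j^\dagger=\tfrac1{\sqrt2}(\hat q_j-i\hat p_j)$, all taken on the Schwartz space $\mathcal S(\mathbb{R}^n)$. The Schwinger $U(2)$ operators of the qumodes $r,s$ are $\hat S^0_{r,s}=\tfrac12(\hat a_r^\dagger\hat a_r+\hat a_s^\dagger\hat a_s)$, $\hat S^x_{r,s}=\tfrac12(\hat a_r^\dagger\hat a_s+\hat a_s^\dagger\hat a_r)$, $\hat S^y_{r,s}=\tfrac1{2i}(\hat a_r^\dagger\hat a_s-\hat a_s^\dagger\hat a_r)$, $\hat S^z_{r,s}=\tfrac12(\hat a_r^\dagger\hat a_r-\hat a_s^\dagger\hat a_s)$. Let $|\phi_{\mathbf K}\rangle$ be a Gaussian pure state with adjacency matrix $\mathbf K$, i.e. the state with wavefunction $$\psi_{\mathbf Z}(\mathbf q)=\frac{\det(\mathbf U)^{1/4}}{\pi^{n/4}}\exp\!\left(\tfrac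 i2\,\mathbf q^T\mathbf Z\mathbf q\right),\qquad \mathbf Z=\mathbf V+i\mathbf U,\quad \mathbf K=(\mathbf I+i\mathbf Z)(\mathbf I-i\mathbf Z)^{-1},$$ where $\mathbf V,\mathbf U$ are real symmetric $n\times n$ matrices and $\mathbf U$ is positive definite. Let $\hat N$ be a Schwinger nullifier for this state, i.e. a real linear combination of Schwinger $U(2)$ operators with $\hat N|\phi_{\mathbf K}\rangle=0$. Then there is exactly one strongly continuous one-parameter group of unitary operators $\hat U(\theta)=e^{-i\theta\hat N}$, $\theta\in\mathbb{R}$, on $L^2(\mathbb{R}^n)$ whose generator (in the sense of Stone) is the closure of $\hat N$. For every $\theta\in\mathbb{R}$, $\hat U(\theta)$ is a passive interferometric operation, that is, it is of the form $e^{-i\hat H}$ with $\hat H=\sum_{i,j}\Pi_{ij}\hat a_i^\dagger\hat a_j$ for some Hermitian matrix $\Pi$; it conserves the total photon number, that is, it maps the domain of the closure of $\sum_i\hat a_i^\dagger\hat a_i$ into itself and commutes with this operator there; and it leaves the state invariant: $\hat U(\theta)|\phi_{\mathbf K}\rangle=|\phi_{\mathbf K}\rangle$. -/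

import Mathlib

open MeasureTheory Matrix Complex
open scoped SchwartzMap LineDeriv

noncomputable section

namespace Qumode

/-- Configuration space of `n` qumodes: the vectors of positions. -/
abbrev Pos (n : ℕ) : Type := EuclideanSpace ℝ (Fin n)

/-- The state space of `n` qumodes, in the position representation. -/
abbrev Hilb (n : ℕ) : Type := Lp ℂ 2 (volume : Measure (Pos n))

/-- Operators with domain the Schwartz space, a common invariant dense domain of all polynomials
in the quadrature operators. -/
abbrev Op (n : ℕ) : Type := Module.End ℂ 𝓢(Pos n, ℂ)

/-- The vector of the state space given by a Schwartz wavefunction. -/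
def toState {n : ℕ} (ψ : 𝓢(Pos n, ℂ)) : Hilb n := ψ.toLp 2 volume

/-- The position operator of qumode `j`. -/
def position {n : ℕ} (j : Fin n) : Op n :=
  (SchwartzMap.smulLeftCLM ℂ (fun x : Pos n => ((x j : ℝ) : ℂ))).toLinearMap

theorem position_apply {n : ℕ} (j : Fin n) (ψ : 𝓢(Pos n, ℂ)) (x : Pos n) :
    position j ψ x = (x j : ℂ) * ψ x := by
  have h : (fun x : Pos n => ((x j : ℝ) : ℂ)).HasTemperateGrowth :=
    (Complex.ofRealCLM.comp (EuclideanSpace.proj j : Pos n →L[ℝ] ℝ)).hasTemperateGrowth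
  simp [position, SchwartzMap.smulLeftCLM_apply_apply h]

/-- The momentum operator of qumode `j`, with `ħ = 1`. -/
def momentum {n : ℕ} (j : Fin n) : Op n :=
  (-I) • (LineDeriv.lineDerivOpCLM ℂ 𝓢(Pos n, ℂ)
    (EuclideanSpace.single j (1 : ℝ))).toLinearMap

theorem momentum_apply {n : ℕ} (j : Fin n) (ψ : 𝓢(Pos n, ℂ)) (x : Pos n) :
    momentum j ψ x = -I * fderiv ℝ ψ x (EuclideanSpace.single j (1 : ℝ)) := by
  simp [momentum, SchwartzMap.lineDerivOp_apply_eq_fderiv]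

/-- The annihilation operator of qumode `j`. -/
def annih {n : ℕ} (j : Fin n) : Op n :=
  ((1 / Real.sqrt 2 : ℝ) : ℂ) • (position j + I • momentum j)

/-- The creation operator of qumode `j`. -/
def creat {n : ℕ} (j : Fin n) : Op n :=
  ((1 / Real.sqrt 2 : ℝ) : ℂ) • (position j - I • momentum j)

/-- The labels of the four generators of `U(2)`. -/
inductive Axis
  | zero
  | x
  | y
  | z

/-- The Schwinger `U(2)` operators of the qumodes `r` and `s`. -/
def schwinger {n : ℕ} (r s : Fin n) : Axis → Op n
  | Axis.zero => (1 / 2 : ℂ) • (creat r * annih r + creat s * annih s)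
  | Axis.x => (1 / 2 : ℂ) • (creat r * annih s + creat s * annih r)
  | Axis.y => (1 / (2 * I) : ℂ) • (creat r * annih s - creat s * annih r)
  | Axis.z => (1 / 2 : ℂ) • (creat r * annih r - creat s * annih s)

/-- The real linear combinations of Schwinger `U(2)` operators. (With `r = s` allowed the single
mode number operator is one of them also if `n = 1`; if `n ≥ 2` the combinations are the same as
those for `r ≠ s`.) -/
def IsSchwingerCombination {n : ℕ} (N : Op n) : Prop :=
  ∃ c : Fin n → Fin n → Axis → ℝ,
    N = ∑ r, ∑ s, (((c r s Axis.zero : ℝ) : ℂ) • schwinger r s Axis.zero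
      + ((c r s Axis.x : ℝ) : ℂ) • schwinger r s Axis.x
      + ((c r s Axis.y : ℝ) : ℂ) • schwinger r s Axis.y
      + ((c r s Axis.z : ℝ) : ℂ) • schwinger r s Axis.z)

/-- `φ` is in the domain of `N` and `N φ = 0`. -/
def IsNullifier {n : ℕ} (N : Op n) (φ : Hilb n) : Prop :=
  ∃ ψ : 𝓢(Pos n, ℂ), toState ψ = φ ∧ N ψ = 0

/-- A Schwinger nullifier of the state `φ`. -/
def IsSchwingerNullifier {n : ℕ} (N : Op n) (φ : Hilb n) : Prop :=
  IsSchwingerCombination N ∧ IsNullifier N φ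

/-- The matrix `Z = V + iU`. -/
def graphMatrix {n : ℕ} (V U : Matrix (Fin n) (Fin n) ℝ) : Matrix (Fin n) (Fin n) ℂ :=
  V.map (fun a : ℝ => (a : ℂ)) + I • U.map (fun a : ℝ => (a : ℂ))

/-- The wavefunction `det(U)^{1/4} π^{-n/4} exp((i/2) qᵀ Z q)`, where `Z = V + iU`. -/
def gaussianWave {n : ℕ} (V U : Matrix (Fin n) (Fin n) ℝ) (q : Pos n) : ℂ :=
  ((U.det ^ (1 / 4 : ℝ) / Real.pi ^ ((n : ℝ) / 4) : ℝ) : ℂ) *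
    Complex.exp (I / 2 * ∑ i, ∑ j, (q i : ℂ) * graphMatrix V U i j * (q j : ℂ))

/-- `φ` is the Gaussian pure state with adjacency matrix `K`. -/
def IsGaussianPureState {n : ℕ} (K : Matrix (Fin n) (Fin n) ℂ) (φ : Hilb n) : Prop :=
  ∃ V U : Matrix (Fin n) (Fin n) ℝ, V.IsSymm ∧ U.PosDef ∧
    K = (1 + I • graphMatrix V U) * (1 - I • graphMatrix V U)⁻¹ ∧
    (φ : Pos n → ℂ) =ᵐ[volume] gaussianWave V U

/-- The graph of the closure of the operator `A`. -/
def closedGraph {n : ℕ} (A : Op n) : Set (Hilb n × Hilb n) :=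
  closure (Set.range fun ψ : 𝓢(Pos n, ℂ) => (toState ψ, toState (A ψ)))

/-- `U` is the one-parameter unitary group `θ ↦ exp(-iθA)`: a strongly continuous unitary
representation of the real line whose infinitesimal generator, in the sense of Stone, is exactly
the closure of `A`. -/
structure IsExpGroup {n : ℕ} (A : Op n) (U : ℝ → Hilb n →L[ℂ] Hilb n) : Prop where
  mem_unitary : ∀ θ, U θ ∈ unitary (Hilb n →L[ℂ] Hilb n)
  map_zero : U 0 = 1
  map_add : ∀ θ θ', U (θ + θ') = U θ * U θ'
  strongly_continuous : ∀ f, Continuous fun θ => U θ f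
  generator : {p : Hilb n × Hilb n | HasDerivAt (fun θ : ℝ => U θ p.1) (-(I • p.2)) 0}
    = closedGraph A

/-- The Hamiltonian `∑ Πᵢⱼ aᵢ† aⱼ`. -/
def quadHamiltonian {n : ℕ} (P : Matrix (Fin n) (Fin n) ℂ) : Op n :=
  ∑ i, ∑ j, P i j • (creat i * annih j)

/-- Passive interferometric operations: the unitaries `exp(-iH)`, where `H = ∑ Πᵢⱼ aᵢ† aⱼ` with `Π`
Hermitian is a compact quadratic Hamiltonian. -/
def IsPassiveInterferometric {n : ℕ} (W : Hilb n →L[ℂ] Hilb n) : Prop :=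
  ∃ P : Matrix (Fin n) (Fin n) ℂ, P.IsHermitian ∧
    ∃ U : ℝ → Hilb n →L[ℂ] Hilb n, IsExpGroup (quadHamiltonian P) U ∧ W = U 1

/-- The total photon number operator. -/
def totalNumber (n : ℕ) : Op n := ∑ i, creat i * annih i

/-- `W` conserves the total photon number: it maps the domain of the (closed) total photon number
operator into itself and commutes with that operator there. -/
def ConservesPhotonNumber {n : ℕ} (W : Hilb n →L[ℂ] Hilb n) : Prop :=
  ∀ f g : Hilb n, (f, g) ∈ closedGraph (totalNumber n) →
    (W f, W g) ∈ closedGraph (totalNumber n)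

end Qumode

end

/-! Every real combination of Schwinger operators is `quadHamiltonian P` with `P` Hermitian, since
each Schwinger operator is (`exists_isHermitian_schwinger`). Such an operator is symmetric and,
having one creation and one annihilation operator in each term, preserves each space of
wavefunctions with `m` photons. These spaces are finite dimensional and mutually orthogonal, and
together they are total in the Hilbert space. Diagonalising on each of them yields an orthonormal
basis of Schwartz functions that are eigenvectors of both the nullifier and the total photon number
(`exists_eigenbasis`).

A symmetric operator with such a basis has as its closure the maximal diagonal operator
(`closedGraph_eq_of_eigenbasis`), and multiplying coordinates by the phases exp(-iθλ) gives a
unitary group with exactly this generator. Any group with this generator must act on eigenvectors by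
the same phases (`IsExpGroup.apply_eigenvector`), hence uniqueness. Invariance of the state is the
case of eigenvalue 0, and photon number is conserved because both operators are diagonal in one
basis.

The analytic core is totality (`eq_zero_of_inner_polynomial_vacuum_eq_zero`): if f is orthogonal to
all polynomials times the Gaussian, the product of f with the Gaussian has vanishing moments, hence
vanishing Fourier transform. -/

noncomputable section

/-! ### Unitary groups diagonal in a Hilbert basis. -/

namespace HilbertBasis

open Filter Topology

variable {ι H : Type*} [NormedAddCommGroup H] [InnerProductSpace ℂ H]

theorem hasSum_norm_repr_sq (b : HilbertBasis ι ℂ H) (x : H) :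
    HasSum (fun k => ‖b.repr x k‖ ^ 2) (‖x‖ ^ 2) := by
  have h := lp.hasSum_norm (p := 2) (by norm_num) (b.repr x)
  simpa using h

theorem ext_repr (b : HilbertBasis ι ℂ H) {x y : H} (h : ∀ k, b.repr x k = b.repr y k) : x = y :=
  b.repr.injective (lp.ext (funext h))

/-- Dominated convergence applied to the Parseval sum. Strong continuity and differentiability of
the diagonal group both reduce to this. -/
theorem tendsto_zero_of_repr (b : HilbertBasis ι ℂ H) {α : Type*} {l : Filter α} {F : α → H}
    (g : ι → ℝ) (hg : Summable g) (hb : ∀ᶠ a in l, ∀ k, ‖b.repr (F a) k‖ ^ 2 ≤ g k)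
    (hF : ∀ k, Tendsto (fun a => b.repr (F a) k) l (𝓝 0)) : Tendsto F l (𝓝 0) := by
  have h : Tendsto (fun a => ∑' k, ‖b.repr (F a) k‖ ^ 2) l (𝓝 (∑' _ : ι, (0 : ℝ))) := by
    refine tendsto_tsum_of_dominated_convergence hg (fun k => ?_) ?_
    · simpa using ((hF k).norm.pow 2)
    · filter_upwards [hb] with a ha k
      simpa using ha k
  simp only [(b.hasSum_norm_repr_sq _).tsum_eq, tsum_zero] at h
  rw [tendsto_zero_iff_norm_tendsto_zero]
  have h2 := (Real.continuous_sqrt.tendsto 0).comp h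
  simpa [Function.comp_def, Real.sqrt_sq] using h2

variable [CompleteSpace H]

/-- The basis obtained by multiplying each basis vector by a phase. -/
def rephase (b : HilbertBasis ι ℂ H) (c : ι → Circle) : HilbertBasis ι ℂ H :=
  HilbertBasis.mkOfOrthogonalEqBot (v := fun k => (c k : ℂ) • b k)
    (by
      classical
      have := b.orthonormal
      rw [orthonormal_iff_ite] at this ⊢
      intro i j
      rw [inner_smul_left, inner_smul_right, this]
      split_ifs with h
      · subst h
        simp [← Complex.normSq_eq_conj_mul_self]
      · simp)
    (by
      rw [Submodule.eq_bot_iff]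
      intro x hx
      refine b.ext_repr fun k => ?_
      have := hx ((c k : ℂ) • b k) (Submodule.subset_span ⟨k, rfl⟩)
      rw [inner_smul_left] at this
      simpa [b.repr_apply_apply] using this)

/-- The unitary operator that multiplies the `k`-th coordinate by the phase `c k`. -/
def diagonal (b : HilbertBasis ι ℂ H) (c : ι → Circle) : H ≃ₗᵢ[ℂ] H :=
  -- Coordinates are read off in `b` and resummed in the rephased basis, so unitarity comes for
  -- free.
  b.repr.trans (b.rephase c).repr.symm

theorem repr_diagonal (b : HilbertBasis ι ℂ H) (c : ι → Circle) (x : H) (k : ι) :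
    b.repr (b.diagonal c x) k = c k * b.repr x k := by
  have h : (b.rephase c).repr (b.diagonal c x) k = b.repr x k := by simp [diagonal]
  have hv : (b.rephase c) k = (c k : ℂ) • b k := by
    unfold rephase
    rw [HilbertBasis.coe_mkOfOrthogonalEqBot]
  rw [HilbertBasis.repr_apply_apply, hv, inner_smul_left, ← HilbertBasis.repr_apply_apply] at h
  rw [← h, ← mul_assoc, Complex.mul_conj]
  simp

/-- The unitary group that multiplies the `k`-th coordinate by `exp(-iθ lam k)`. -/
def expGroup (b : HilbertBasis ι ℂ H) (lam : ι → ℝ) (θ : ℝ) : H →L[ℂ] H :=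
  ((b.diagonal fun k => Circle.exp (-(θ * lam k))).toContinuousLinearEquiv : H →L[ℂ] H)

theorem repr_expGroup (b : HilbertBasis ι ℂ H) (lam : ι → ℝ) (θ : ℝ) (x : H) (k : ι) :
    b.repr (b.expGroup lam θ x) k = Complex.exp (-(θ * lam k * I)) * b.repr x k := by
  have := b.repr_diagonal (fun k => Circle.exp (-(θ * lam k))) x k
  simp only [Circle.coe_exp] at this
  have hk : ((-(θ * lam k) : ℝ) : ℂ) * I = -(θ * lam k * I) := by push_cast; ring
  rw [hk] at this
  exact this

theorem expGroup_mem_unitary (b : HilbertBasis ι ℂ H) (lam : ι → ℝ) (θ : ℝ) :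
    b.expGroup lam θ ∈ unitary (H →L[ℂ] H) :=
  (Unitary.linearIsometryEquiv.symm (b.diagonal fun k => Circle.exp (-(θ * lam k)))).2

theorem expGroup_zero (b : HilbertBasis ι ℂ H) (lam : ι → ℝ) : b.expGroup lam 0 = 1 := by
  ext x
  refine b.ext_repr fun k => ?_
  simp [repr_expGroup]

theorem expGroup_add (b : HilbertBasis ι ℂ H) (lam : ι → ℝ) (θ θ' : ℝ) :
    b.expGroup lam (θ + θ') = b.expGroup lam θ * b.expGroup lam θ' := by
  ext x
  refine b.ext_repr fun k => ?_
  rw [mul_apply_eq_comp]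
  simp only [repr_expGroup]
  rw [← mul_assoc, ← Complex.exp_add]
  congr 2
  push_cast
  ring

theorem continuous_expGroup (b : HilbertBasis ι ℂ H) (lam : ι → ℝ) (x : H) :
    Continuous fun θ => b.expGroup lam θ x := by
  rw [continuous_iff_continuousAt]
  intro θ
  have key : Tendsto (fun t => b.expGroup lam t x - b.expGroup lam θ x) (𝓝 θ) (𝓝 0) := by
    -- Two phases differ by at most 2 in modulus, which gives 4 after squaring.
    refine b.tendsto_zero_of_repr (fun k => 4 * ‖b.repr x k‖ ^ 2)
      ((b.hasSum_norm_repr_sq x).summable.mul_left 4) (Eventually.of_forall fun t k => ?_)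
      fun k => ?_
    · have h : ‖b.repr (b.expGroup lam t x - b.expGroup lam θ x) k‖ ≤ 2 * ‖b.repr x k‖ := by
        rw [map_sub, lp.coeFn_sub, Pi.sub_apply, repr_expGroup, repr_expGroup]
        refine (norm_sub_le _ _).trans (le_of_eq ?_)
        simp only [norm_mul, Complex.norm_exp]
        simp
        ring
      calc _ ≤ (2 * ‖b.repr x k‖) ^ 2 := by gcongr
        _ = _ := by ring
    · simp only [map_sub, lp.coeFn_sub, Pi.sub_apply, repr_expGroup]
      have hc : Continuous fun t : ℝ => Complex.exp (-(t * lam k * I)) * b.repr x k -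
          Complex.exp (-(θ * lam k * I)) * b.repr x k := by fun_prop
      simpa using hc.tendsto θ
  have := key.add_const (b.expGroup lam θ x)
  simpa [ContinuousAt] using this

/-- Coordinates are continuous functionals, which gives one direction. Conversely, the coordinates
of the difference quotient are bounded by |λₖ xₖ| = |yₖ|, which is square summable because y is a
vector of the space; no separate domain condition is needed. -/
theorem hasDerivAt_expGroup_zero_iff (b : HilbertBasis ι ℂ H) (lam : ι → ℝ) (x y : H) :
    HasDerivAt (fun θ : ℝ => b.expGroup lam θ x) (-(I • y)) 0 ↔
      ∀ k, b.repr y k = lam k * b.repr x k := by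
  have hcoord : ∀ k, HasDerivAt (fun θ : ℝ => Complex.exp (-(θ * lam k * I)) * b.repr x k)
      (-(lam k * I) * b.repr x k) 0 := by
    intro k
    have h1 : HasDerivAt (fun θ : ℝ => -((θ : ℂ) * lam k * I)) (-(lam k * I)) 0 := by
      have := ((Complex.ofRealCLM.hasDerivAt (x := (0 : ℝ))).mul_const ((lam k : ℂ) * I)).fun_neg
      simpa [mul_assoc] using this
    simpa using h1.cexp.mul_const (b.repr x k)
  constructor
  · intro h k
    have h1 : HasDerivAt (fun θ : ℝ => inner ℂ (b k) (b.expGroup lam θ x))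
        (inner ℂ (b k) (-(I • y))) 0 :=
      ((innerSL ℂ (b k)).restrictScalars ℝ).hasFDerivAt.comp_hasDerivAt (0 : ℝ) h
    simp only [← HilbertBasis.repr_apply_apply, repr_expGroup] at h1
    have h2 := h1.unique (hcoord k)
    rw [map_neg, map_smul, lp.coeFn_neg, lp.coeFn_smul, Pi.neg_apply, Pi.smul_apply,
      smul_eq_mul] at h2
    apply mul_left_cancel₀ I_ne_zero
    linear_combination -h2
  · intro h
    rw [hasDerivAt_iff_tendsto_slope_zero]
    have hb : ∀ (t : ℝ) k, b.repr (t⁻¹ • (b.expGroup lam (0 + t) x - b.expGroup lam 0 x) -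
        -(I • y)) k =
        t⁻¹ • (Complex.exp (-(t * lam k * I)) * b.repr x k -
          Complex.exp (-((0 : ℝ) * lam k * I)) * b.repr x k) + I * (lam k * b.repr x k) := by
      intro t k
      rw [← Complex.coe_smul, map_sub, map_smul, map_neg, map_smul, map_sub]
      simp only [lp.coeFn_sub, lp.coeFn_neg, lp.coeFn_smul, Pi.sub_apply, Pi.neg_apply,
        Pi.smul_apply, repr_expGroup, h, zero_add]
      simp
    have key : Tendsto (fun t : ℝ => t⁻¹ • (b.expGroup lam (0 + t) x - b.expGroup lam 0 x) -
        -(I • y)) (𝓝[≠] 0) (𝓝 0) := by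
      refine b.tendsto_zero_of_repr (fun k => 4 * ‖b.repr y k‖ ^ 2)
        ((b.hasSum_norm_repr_sq y).summable.mul_left 4) ?_ fun k => ?_
      · filter_upwards [self_mem_nhdsWithin] with t ht k
        have ht' : t ≠ 0 := ht
        have h1 : ‖Complex.exp (-(t * lam k * I)) - 1‖ ≤ |t| * |lam k| := by
          have := Real.norm_exp_I_mul_ofReal_sub_one_le (x := -(t * lam k))
          rw [norm_neg, norm_mul, Real.norm_eq_abs, Real.norm_eq_abs] at this
          convert this using 4
          push_cast
          ring
        -- One ‖yₖ‖ bounds the difference quotient, the other is the limit being subtracted.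
        have h2 : ‖b.repr (t⁻¹ • (b.expGroup lam (0 + t) x - b.expGroup lam 0 x) -
            -(I • y)) k‖ ≤ 2 * ‖b.repr y k‖ := by
          rw [hb, h]
          refine (norm_add_le _ _).trans ?_
          rw [ofReal_zero, zero_mul, zero_mul, neg_zero, Complex.exp_zero, ← sub_mul, norm_smul,
            norm_mul, norm_mul, norm_mul, norm_I, norm_inv, Complex.norm_real, Real.norm_eq_abs,
            Real.norm_eq_abs]
          have h3 : |t|⁻¹ * (‖Complex.exp (-(t * lam k * I)) - 1‖ * ‖b.repr x k‖) ≤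
              |t|⁻¹ * ((|t| * |lam k|) * ‖b.repr x k‖) := by gcongr
          have h4 : |t|⁻¹ * ((|t| * |lam k|) * ‖b.repr x k‖) = |lam k| * ‖b.repr x k‖ := by
            have : |t| ≠ 0 := abs_ne_zero.mpr ht'
            field_simp
          linarith
        calc _ ≤ (2 * ‖b.repr y k‖) ^ 2 := by gcongr
          _ = _ := by ring
      · simp only [hb]
        have h1 := (hasDerivAt_iff_tendsto_slope_zero.mp (hcoord k)).add_const
          (I * (lam k * b.repr x k))
        simp only [zero_add] at h1
        convert h1 using 2
        ring
    have := key.add_const (-(I • y))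
    simpa using this

end HilbertBasis

namespace Qumode

/-! ### Symmetric operators with an eigenbasis of Schwartz functions. -/

variable {n : ℕ}

theorem toState_add (ψ χ : 𝓢(Pos n, ℂ)) : toState (ψ + χ) = toState ψ + toState χ :=
  map_add (SchwartzMap.toLpCLM ℂ ℂ 2 (volume : Measure (Pos n))) ψ χ

theorem toState_smul (c : ℂ) (ψ : 𝓢(Pos n, ℂ)) : toState (c • ψ) = c • toState ψ :=
  map_smul (SchwartzMap.toLpCLM ℂ ℂ 2 (volume : Measure (Pos n))) c ψ

/-- The embedding of the Schwartz space into the state space. -/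
def toStateₗ (n : ℕ) : 𝓢(Pos n, ℂ) →ₗ[ℂ] Hilb n where
  toFun := toState
  map_add' := toState_add
  map_smul' := toState_smul

@[simp] theorem toStateₗ_apply (ψ : 𝓢(Pos n, ℂ)) : toStateₗ n ψ = toState ψ := rfl

theorem toState_injective : Function.Injective (toState (n := n)) :=
  SchwartzMap.injective_toLp 2 volume

/-- `A` is symmetric with respect to the inner product of the state space. -/
def IsSymmetricOp (A : Op n) : Prop :=
  ∀ ψ χ, inner ℂ (toState (A ψ)) (toState χ) = inner ℂ (toState ψ) (toState (A χ))

/-- The graph of `A` as a subspace. -/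
def graphSubmodule (A : Op n) : Submodule ℂ (Hilb n × Hilb n) :=
  LinearMap.range ((toStateₗ n).prod ((toStateₗ n).comp A))

theorem coe_topologicalClosure_graphSubmodule (A : Op n) :
    ((graphSubmodule A).topologicalClosure : Set (Hilb n × Hilb n)) = closedGraph A := by
  rw [Submodule.topologicalClosure_coe, graphSubmodule, LinearMap.coe_range]
  rfl

/-- By symmetry the graph of `A` satisfies the coordinate equations, and these define a closed set.
Conversely, the partial sums of the two eigenexpansions form pairs in the graph of `A` that converge
to (f, g). -/
theorem closedGraph_eq_of_eigenbasis {ι : Type*} {A : Op n} (hA : IsSymmetricOp A)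
    (b : HilbertBasis ι ℂ (Hilb n)) (e : ι → 𝓢(Pos n, ℂ)) (he : ∀ k, toState (e k) = b k)
    (lam : ι → ℝ) (hlam : ∀ k, A (e k) = (lam k : ℂ) • e k) :
    closedGraph A = {p | ∀ k, b.repr p.2 k = lam k * b.repr p.1 k} := by
  apply Set.Subset.antisymm
  · refine closure_minimal ?_ ?_
    · rintro _ ⟨ψ, rfl⟩ k
      simp only [b.repr_apply_apply, ← he]
      rw [← hA, hlam, toState_smul, inner_smul_left]
      simp
    · simp only [b.repr_apply_apply, Set.ofPred_forall]
      exact isClosed_iInter fun k => isClosed_eq (by fun_prop) (by fun_prop)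
  · rintro ⟨f, g⟩ h
    have h1 := b.hasSum_repr f
    have h2 := b.hasSum_repr g
    have h3 := h1.prodMk h2
    rw [← coe_topologicalClosure_graphSubmodule]
    refine (Submodule.isClosed_topologicalClosure _).mem_of_tendsto h3
      (Filter.Eventually.of_forall fun s => ?_)
    refine Submodule.le_topologicalClosure _ (Submodule.sum_mem _ fun k _ => ?_)
    refine ⟨b.repr f k • e k, ?_⟩
    have hk : b.repr g k = lam k * b.repr f k := h k
    refine Prod.ext ?_ ?_
    · simp [he]
    · change toState (A (b.repr f k • e k)) = b.repr g k • b k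
      rw [map_smul, hlam, toState_smul, toState_smul, he, hk, smul_smul, mul_comm]

theorem isExpGroup_expGroup {ι : Type*} {A : Op n} (hA : IsSymmetricOp A)
    (b : HilbertBasis ι ℂ (Hilb n)) (e : ι → 𝓢(Pos n, ℂ)) (he : ∀ k, toState (e k) = b k)
    (lam : ι → ℝ) (hlam : ∀ k, A (e k) = (lam k : ℂ) • e k) :
    IsExpGroup A (b.expGroup lam) where
  mem_unitary := b.expGroup_mem_unitary lam
  map_zero := b.expGroup_zero lam
  map_add := b.expGroup_add lam
  strongly_continuous := b.continuous_expGroup lam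
  generator := by
    rw [closedGraph_eq_of_eigenbasis hA b e he lam hlam]
    ext p
    exact b.hasDerivAt_expGroup_zero_iff lam p.1 p.2

/-- The group law carries the derivative at 0 to every time, so exp(iμt) U(t)ψ has zero derivative
and is constant. Only the abstract properties of the group enter, so this also serves for
uniqueness. -/
theorem IsExpGroup.apply_eigenvector {A : Op n} {U : ℝ → Hilb n →L[ℂ] Hilb n}
    (hU : IsExpGroup A U) {ψ : 𝓢(Pos n, ℂ)} {μ : ℝ} (hψ : A ψ = (μ : ℂ) • ψ) (θ : ℝ) :
    U θ (toState ψ) = Complex.exp (-(θ * μ * I)) • toState ψ := by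
  have h0 : HasDerivAt (fun t : ℝ => U t (toState ψ)) (-(I • (μ : ℂ) • toState ψ)) 0 := by
    have : (toState ψ, (μ : ℂ) • toState ψ) ∈ closedGraph A := by
      rw [← toState_smul, ← hψ]
      exact subset_closure ⟨ψ, rfl⟩
    rw [← hU.generator] at this
    exact this
  have h1 : ∀ t : ℝ, HasDerivAt (fun s : ℝ => U s (toState ψ))
      (U t (-(I • (μ : ℂ) • toState ψ))) t := by
    intro t
    have h2 : HasDerivAt (fun s : ℝ => U (s - t) (toState ψ)) (-(I • (μ : ℂ) • toState ψ)) t := by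
      rw [← sub_self t] at h0
      exact h0.comp_sub_const t t
    have h3 := ((U t).restrictScalars ℝ).hasFDerivAt.comp_hasDerivAt t h2
    convert! h3 using 1
    ext1 s
    simp [← mul_apply_eq_comp, ← hU.map_add]
  have h4 : ∀ t : ℝ, HasDerivAt (fun s : ℝ => Complex.exp (s * μ * I) • U s (toState ψ)) 0 t := by
    intro t
    have h5 : HasDerivAt (fun s : ℝ => Complex.exp (s * μ * I))
        (Complex.exp (t * μ * I) * (μ * I)) t := by
      have h6 : HasDerivAt (fun s : ℝ => (s : ℂ) * μ * I) (μ * I) t := by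
        have := (Complex.ofRealCLM.hasDerivAt (x := t)).mul_const ((μ : ℂ) * I)
        simpa [mul_assoc] using this
      exact h6.cexp
    have h7 := h5.smul (h1 t)
    convert! h7 using 1
    rw [map_neg, map_smul, map_smul, smul_neg, smul_smul, smul_smul]
    rw [show cexp (t * μ * I) * I * μ = cexp (t * μ * I) * (μ * I) by ring]
    simp
  have h8 : Complex.exp (θ * μ * I) • U θ (toState ψ) = toState ψ := by
    have := is_const_of_deriv_eq_zero (fun t => (h4 t).differentiableAt) (fun t => (h4 t).deriv) θ 0
    simpa [hU.map_zero] using this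
  rw [← h8, smul_smul, ← Complex.exp_add, h8]
  simp

theorem IsExpGroup.unique_of_eigenbasis {ι : Type*} {A : Op n} {U U' : ℝ → Hilb n →L[ℂ] Hilb n}
    (hU : IsExpGroup A U) (hU' : IsExpGroup A U')
    (b : HilbertBasis ι ℂ (Hilb n)) (e : ι → 𝓢(Pos n, ℂ)) (he : ∀ k, toState (e k) = b k)
    (lam : ι → ℝ) (hlam : ∀ k, A (e k) = (lam k : ℂ) • e k) : U' = U := by
  ext1 θ
  refine ContinuousLinearMap.ext_on (s := Set.range b) ?_ ?_
  · have := b.dense_span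
    rwa [← Submodule.dense_iff_topologicalClosure_eq_top] at this
  · rintro _ ⟨k, rfl⟩
    rw [← he, hU.apply_eigenvector (hlam k), hU'.apply_eigenvector (hlam k)]

/-! ### The Gaussian vacuum as a Schwartz function. -/

theorem hasTemperateGrowth_neg_half_norm_sq {E : Type*} [NormedAddCommGroup E]
    [InnerProductSpace ℝ E] : (fun x : E => -(‖x‖ ^ 2 / 2)).HasTemperateGrowth := by
  have h1 := Function.HasTemperateGrowth.mul (Function.HasTemperateGrowth.const (E := E)
    (-(1 / 2) : ℝ)) (Function.hasTemperateGrowth_norm_sq (H := E))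
  have h2 : (fun x : E => -(‖x‖ ^ 2 / 2)) = fun x => -(1 / 2) * ‖x‖ ^ 2 := by
    funext x
    ring
  rw [h2]
  exact h1

theorem one_add_pow_mul_exp_neg_sq_le (p : ℕ) {r : ℝ} (hr : 0 ≤ r) :
    (1 + r) ^ p * Real.exp (-(r ^ 2 / 2)) ≤ p.factorial * Real.exp (3 / 2) := by
  have h1 := Real.pow_div_factorial_le_exp (x := 1 + r) (by positivity) p
  rw [div_le_iff₀ (by positivity)] at h1
  calc (1 + r) ^ p * Real.exp (-(r ^ 2 / 2))
      ≤ Real.exp (1 + r) * p.factorial * Real.exp (-(r ^ 2 / 2)) := by gcongr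
    _ = p.factorial * Real.exp (1 + r - r ^ 2 / 2) := by
        rw [sub_eq_add_neg, Real.exp_add (1 + r)]; ring
    _ ≤ _ := by
        gcongr
        -- 1 + r - r²/2 = 3/2 - (r - 1)²/2.
        nlinarith [sq_nonneg (r - 1)]

/-- All derivatives of `exp` equal `exp`, so the bound for derivatives of a composition keeps the
Gaussian factor and costs only a power of 1 + ‖x‖. -/
theorem norm_pow_mul_iteratedFDeriv_gaussian_le {E : Type*} [NormedAddCommGroup E]
    [InnerProductSpace ℝ E] (k m : ℕ) :
    ∃ C : ℝ, ∀ x : E, ‖x‖ ^ k *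
      ‖iteratedFDeriv ℝ m (fun x : E => ((Real.exp (-(‖x‖ ^ 2 / 2)) : ℝ) : ℂ)) x‖ ≤ C := by
  obtain ⟨p, C, hC0, hC⟩ := (hasTemperateGrowth_neg_half_norm_sq (E := E)).norm_iteratedFDeriv_le_uniform m
  refine ⟨m.factorial * (1 + C) ^ m * ((k + p * m).factorial * Real.exp (3 / 2)), fun x => ?_⟩
  have h1 : ‖iteratedFDeriv ℝ m (fun x : E => ((Real.exp (-(‖x‖ ^ 2 / 2)) : ℝ) : ℂ)) x‖
      = ‖iteratedFDeriv ℝ m (Real.exp ∘ fun x : E => -(‖x‖ ^ 2 / 2)) x‖ :=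
    Complex.ofRealLI.norm_iteratedFDeriv_comp_left
      (Real.contDiff_exp.comp (hasTemperateGrowth_neg_half_norm_sq (E := E)).1).contDiffAt
      (by exact_mod_cast le_top)
  have h2 : ‖iteratedFDeriv ℝ m (Real.exp ∘ fun x : E => -(‖x‖ ^ 2 / 2)) x‖ ≤
      m.factorial * Real.exp (-(‖x‖ ^ 2 / 2)) * ((1 + C) * (1 + ‖x‖) ^ p) ^ m := by
    refine norm_iteratedFDeriv_comp_le Real.contDiff_exp
      (hasTemperateGrowth_neg_half_norm_sq (E := E)).1 (N := ((⊤ : ℕ∞) : WithTop ℕ∞)) (by exact_mod_cast le_top) x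
      (fun i _ => ?_) fun i hi him => ?_
    · rw [norm_iteratedFDeriv_eq_norm_iteratedDeriv, iteratedDeriv_eq_iterate,
        Real.iter_deriv_exp, Real.norm_eq_abs, Real.abs_exp]
    -- The constant is enlarged from `C` to `1 + C` to make the base at least 1, hence at most its
    -- i-th power.
    · have h3 : (1 : ℝ) ≤ (1 + C) * (1 + ‖x‖) ^ p :=
        one_le_mul_of_one_le_of_one_le (by linarith)
          (one_le_pow₀ (by linarith [norm_nonneg x]))
      calc _ ≤ C * (1 + ‖x‖) ^ p := hC i him x
        _ ≤ (1 + C) * (1 + ‖x‖) ^ p := by gcongr; linarith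
        _ ≤ _ := le_self_pow₀ h3 (by omega)
  rw [h1]
  calc _ ≤ (1 + ‖x‖) ^ k * (m.factorial * Real.exp (-(‖x‖ ^ 2 / 2)) *
        ((1 + C) * (1 + ‖x‖) ^ p) ^ m) := by
        gcongr
        linarith
    _ = m.factorial * (1 + C) ^ m * ((1 + ‖x‖) ^ (k + p * m) * Real.exp (-(‖x‖ ^ 2 / 2))) := by
        rw [mul_pow, ← pow_mul, pow_add]; ring
    _ ≤ _ := by
        refine mul_le_mul_of_nonneg_left ?_ (by positivity)
        exact one_add_pow_mul_exp_neg_sq_le _ (norm_nonneg x)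

/-- The (unnormalized) vacuum state `exp(-‖q‖² / 2)`. -/
def vacuum (n : ℕ) : 𝓢(Pos n, ℂ) where
  toFun x := ((Real.exp (-(‖x‖ ^ 2 / 2)) : ℝ) : ℂ)
  smooth' := Complex.ofRealCLM.contDiff.comp
    (Real.contDiff_exp.comp hasTemperateGrowth_neg_half_norm_sq.1)
  decay' := norm_pow_mul_iteratedFDeriv_gaussian_le

theorem vacuum_apply (x : Pos n) : vacuum n x = ((Real.exp (-(‖x‖ ^ 2 / 2)) : ℝ) : ℂ) := rfl

theorem annih_vacuum (j : Fin n) : annih j (vacuum n) = 0 := by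
  ext x
  have h1 : HasFDerivAt (fun y : Pos n => -(‖y‖ ^ 2 / 2)) (-((1 / 2 : ℝ) • (2 • innerSL ℝ x))) x := by
    have := ((hasStrictFDerivAt_norm_sq x).hasFDerivAt.const_mul (1 / 2)).fun_neg
    convert! this using 2
    ring
  have h2 : HasFDerivAt (vacuum n) _ x := Complex.ofRealCLM.hasFDerivAt.comp x h1.exp
  simp only [annih, LinearMap.smul_apply, LinearMap.add_apply, _root_.smul_apply,
    _root_.add_apply, position_apply, momentum_apply, h2.fderiv, vacuum_apply]
  simp [EuclideanSpace.inner_single_right, smul_eq_mul]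
  linear_combination (x j : ℂ) * cexp (-(‖x‖ ^ 2 / 2)) * I_sq

/-! ### Canonical commutation relations. -/

theorem position_comm (i j : Fin n) (ψ : 𝓢(Pos n, ℂ)) :
    position i (position j ψ) = position j (position i ψ) := by
  ext x
  simp only [position_apply]
  ring

theorem momentum_comm (i j : Fin n) (ψ : 𝓢(Pos n, ℂ)) :
    momentum i (momentum j ψ) = momentum j (momentum i ψ) := by
  have key : ∀ v w : Pos n, ∂_{v} (∂_{w} ψ) = ∂_{w} (∂_{v} ψ) := by
    intro v w
    ext x
    have h : ∀ v w : Pos n, (∂_{v} (∂_{w} ψ) : 𝓢(Pos n, ℂ)) x = fderiv ℝ (fderiv ℝ ψ) x v w := by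
      intro v w
      rw [SchwartzMap.lineDerivOp_apply_eq_fderiv]
      have h1 : ((∂_{w} ψ : 𝓢(Pos n, ℂ)) : Pos n → ℂ) = fun y => fderiv ℝ ψ y w := by
        ext y
        rw [SchwartzMap.lineDerivOp_apply_eq_fderiv]
      have h2 : DifferentiableAt ℝ (fderiv ℝ ψ) x :=
        ((ψ.smooth 2).fderiv_right (m := 1) (by norm_num)).differentiable (by norm_num) x
      rw [h1, (h2.hasFDerivAt.clm_apply (hasFDerivAt_const w x)).fderiv]
      simp
    rw [h, h]
    refine ((ψ.smooth 2).contDiffAt.isSymmSndFDerivAt (by simp)).eq v w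
  simp only [momentum, LinearMap.smul_apply, map_smul]
  congr 2
  exact key _ _

theorem momentum_position (i j : Fin n) (ψ : 𝓢(Pos n, ℂ)) :
    momentum i (position j ψ) = position j (momentum i ψ) - (if i = j then I else 0) • ψ := by
  ext x
  have h2 : HasFDerivAt (fun y : Pos n => (y j : ℂ))
      (Complex.ofRealCLM.comp (EuclideanSpace.proj j : Pos n →L[ℝ] ℝ)) x :=
    (Complex.ofRealCLM.comp (EuclideanSpace.proj j : Pos n →L[ℝ] ℝ)).hasFDerivAt
  have h3 := h2.fun_mul ((ψ.differentiable x).hasFDerivAt)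
  have h4 : (position j ψ : Pos n → ℂ) = fun y => (y j : ℂ) * ψ y := by
    ext y
    exact position_apply j ψ y
  rw [momentum_apply, h4, h3.fderiv]
  simp only [_root_.sub_apply, _root_.smul_apply, position_apply, momentum_apply]
  simp [eq_comm (a := i)]
  split_ifs <;> simp <;> ring

theorem creat_comm (i j : Fin n) (ψ : 𝓢(Pos n, ℂ)) :
    creat i (creat j ψ) = creat j (creat i ψ) := by
  simp only [creat, LinearMap.smul_apply, LinearMap.sub_apply, map_smul, map_sub]
  simp only [momentum_position, position_comm i j, momentum_comm i j]
  ext x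
  simp only [_root_.sub_apply, _root_.smul_apply, smul_eq_mul, eq_comm (a := i)]
  ring

theorem half_eq_inv_sqrt_two_sq :
    ((1 / Real.sqrt 2 : ℝ) : ℂ) * ((1 / Real.sqrt 2 : ℝ) : ℂ) = 1 / 2 := by
  rw [← ofReal_mul]
  have : 1 / Real.sqrt 2 * (1 / Real.sqrt 2) = 1 / 2 := by
    rw [div_mul_div_comm, Real.mul_self_sqrt (by norm_num)]
    norm_num
  rw [this]
  norm_num

theorem annih_creat (i j : Fin n) (ψ : 𝓢(Pos n, ℂ)) :
    annih i (creat j ψ) = creat j (annih i ψ) + (if i = j then (1 : ℂ) else 0) • ψ := by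
  simp only [annih, creat, LinearMap.smul_apply, LinearMap.add_apply, LinearMap.sub_apply,
    map_smul, map_add, map_sub]
  simp only [momentum_position, position_comm i j, momentum_comm i j]
  ext x
  simp only [_root_.sub_apply, _root_.add_apply, _root_.smul_apply, smul_eq_mul]
  have hs := half_eq_inv_sqrt_two_sq
  generalize ((1 / Real.sqrt 2 : ℝ) : ℂ) = s at hs ⊢
  by_cases h : i = j
  · subst h
    simp only [if_true]
    linear_combination (-2 * s * s * ψ x) * I_sq + 2 * ψ x * hs
  · simp only [h, Ne.symm h, if_false]
    ring

theorem position_eq_creat_add_annih (j : Fin n) (ψ : 𝓢(Pos n, ℂ)) :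
    position j ψ = ((1 / Real.sqrt 2 : ℝ) : ℂ) • (creat j ψ + annih j ψ) := by
  simp only [annih, creat, LinearMap.smul_apply, LinearMap.add_apply, LinearMap.sub_apply]
  rw [← smul_add, smul_smul, half_eq_inv_sqrt_two_sq]
  module

/-! ### Symmetry and adjointness on the Schwartz space. -/

theorem inner_toState (ψ χ : 𝓢(Pos n, ℂ)) :
    inner ℂ (toState ψ) (toState χ) = ∫ x, inner ℂ (ψ x) (χ x) :=
  SchwartzMap.inner_toL2_toL2_eq ψ χ volume

theorem isSymmetricOp_position (j : Fin n) : IsSymmetricOp (position j) := by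
  intro ψ χ
  rw [inner_toState, inner_toState]
  congr 1
  ext x
  simp only [position_apply, RCLike.inner_apply, map_mul, Complex.conj_ofReal]
  ring

theorem isSymmetricOp_momentum (j : Fin n) : IsSymmetricOp (momentum j) := by
  intro ψ χ
  rw [inner_toState, inner_toState]
  -- Integration by parts for the real-bilinear form conj(a) b. Its sign cancels the one from
  -- conjugating -i.
  have h := SchwartzMap.integral_bilinear_lineDerivOp_right_eq_neg_left (μ := volume) ψ χ
    ((ContinuousLinearMap.mul ℝ ℂ).comp (Complex.conjCLE : ℂ →L[ℝ] ℂ))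
    (EuclideanSpace.single j (1 : ℝ))
  have h1 : ∀ x, inner ℂ (momentum j ψ x) (χ x) =
      I * (((ContinuousLinearMap.mul ℝ ℂ).comp (Complex.conjCLE : ℂ →L[ℝ] ℂ))
        ((∂_{EuclideanSpace.single j (1 : ℝ)} ψ : 𝓢(Pos n, ℂ)) x) (χ x)) := by
    intro x
    simp [momentum, RCLike.inner_apply]
    ring
  have h2 : ∀ x, inner ℂ (ψ x) (momentum j χ x) =
      -I * (((ContinuousLinearMap.mul ℝ ℂ).comp (Complex.conjCLE : ℂ →L[ℝ] ℂ))
        (ψ x) ((∂_{EuclideanSpace.single j (1 : ℝ)} χ : 𝓢(Pos n, ℂ)) x)) := by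
    intro x
    simp [momentum, RCLike.inner_apply]
    ring
  simp only [h1, h2]
  rw [integral_const_mul, integral_const_mul, h]
  ring

theorem inner_creat (j : Fin n) (ψ χ : 𝓢(Pos n, ℂ)) :
    inner ℂ (toState (creat j ψ)) (toState χ) = inner ℂ (toState ψ) (toState (annih j χ)) := by
  simp only [annih, creat, LinearMap.smul_apply, LinearMap.add_apply,
    sub_eq_add_neg, ← neg_smul, toState_smul, toState_add, inner_add_left, inner_add_right,
    inner_smul_left, inner_smul_right, isSymmetricOp_position j ψ χ,
    isSymmetricOp_momentum j ψ χ]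
  simp

theorem inner_annih (j : Fin n) (ψ χ : 𝓢(Pos n, ℂ)) :
    inner ℂ (toState (annih j ψ)) (toState χ) = inner ℂ (toState ψ) (toState (creat j χ)) := by
  rw [← inner_conj_symm, ← inner_creat, inner_conj_symm]

theorem toState_sum {ι : Type*} (s : Finset ι) (ψ : ι → 𝓢(Pos n, ℂ)) :
    toState (∑ i ∈ s, ψ i) = ∑ i ∈ s, toState (ψ i) :=
  map_sum (toStateₗ n) ψ s

theorem isSymmetricOp_quadHamiltonian {P : Matrix (Fin n) (Fin n) ℂ} (hP : P.IsHermitian) :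
    IsSymmetricOp (quadHamiltonian P) := by
  intro ψ χ
  simp only [quadHamiltonian, LinearMap.sum_apply, LinearMap.smul_apply, Module.End.mul_apply,
    toState_sum, toState_smul, sum_inner, inner_sum, inner_smul_left, inner_smul_right,
    inner_creat, inner_annih]
  rw [Finset.sum_comm]
  refine Finset.sum_congr rfl fun i _ => Finset.sum_congr rfl fun j _ => ?_
  rw [← hP.apply i j]
  simp

theorem quadHamiltonian_one : quadHamiltonian (1 : Matrix (Fin n) (Fin n) ℂ) = totalNumber n := by
  simp [quadHamiltonian, totalNumber, Matrix.one_apply, ite_smul]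

/-! ### Totality of polynomials times the Gaussian. -/

open FourierTransform in
-- The Fourier transform of h vanishes. Writing a Schwartz function as g = 𝓕(𝓕⁻¹g) and moving 𝓕 onto
-- h shows that h annihilates all test functions.
theorem ae_eq_zero_of_forall_integral_exp_eq_zero {E : Type*} [NormedAddCommGroup E]
    [InnerProductSpace ℝ E] [FiniteDimensional ℝ E] [MeasurableSpace E] [BorelSpace E]
    {h : E → ℂ} (hh : Integrable h)
    (h0 : ∀ ξ : E, ∫ x, Complex.exp (I * (inner ℝ ξ x : ℝ)) * h x = 0) : h =ᵐ[volume] 0 := by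
  have hF : ∀ w, 𝓕 h w = 0 := by
    intro w
    rw [Real.fourier_eq', ← h0 (-(2 * Real.pi) • w)]
    congr 1
    ext x
    rw [smul_eq_mul, real_inner_smul_left, real_inner_comm]
    congr 2
    push_cast
    ring
  have hS : ∀ g : 𝓢(E, ℂ), ∫ x, g x * h x = 0 := by
    intro g
    have h1 : ∫ ξ, 𝓕 ((𝓕⁻ g : 𝓢(E, ℂ)) : E → ℂ) ξ • h ξ =
        ∫ x, (𝓕⁻ g : 𝓢(E, ℂ)) x • 𝓕 h x := by
      have := VectorFourier.integral_fourierIntegral_smul_eq_flip (L := innerₗ E) (μ := volume)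
        (ν := volume) Real.continuous_fourierChar continuous_inner (𝓕⁻ g : 𝓢(E, ℂ)).integrable hh
      rw [flip_innerₗ] at this
      exact this
    rw [← SchwartzMap.fourier_coe, FourierTransform.fourier_fourierInv_eq] at h1
    simpa [hF] using h1
  refine ae_eq_zero_of_integral_contDiff_smul_eq_zero hh.locallyIntegrable fun g hg hc => ?_
  have hg₁ : HasCompactSupport (Complex.ofRealCLM ∘ g) := hc.comp_left rfl
  have hg₂ : ContDiff ℝ ((⊤ : ℕ∞) : WithTop ℕ∞) (Complex.ofRealCLM ∘ g) :=
    Complex.ofRealCLM.contDiff.comp hg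
  simpa using hS (hg₁.toSchwartzMap hg₂)

/-- This makes exp(c‖x‖) integrable against the product of the vacuum with any L² function, which
supplies the dominating function for the exponential series. The constant exp(2c²) comes from
completing the square: 2cr - r²/2 ≤ 2c². -/
theorem memLp_exp_mul_norm_mul_vacuum (c : ℝ) :
    MemLp (fun x : Pos n => Real.exp (c * ‖x‖) * Real.exp (-(‖x‖ ^ 2 / 2))) 2 volume := by
  have hm : Continuous fun x : Pos n => Real.exp (c * ‖x‖) * Real.exp (-(‖x‖ ^ 2 / 2)) := by
    fun_prop
  rw [memLp_two_iff_integrable_sq hm.aestronglyMeasurable]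
  refine Integrable.mono' ((vacuum n).integrable.norm.const_mul (Real.exp (2 * c ^ 2)))
    (hm.pow 2).aestronglyMeasurable (Filter.Eventually.of_forall fun x => ?_)
  rw [vacuum_apply, Complex.norm_real, Real.norm_eq_abs, Real.norm_eq_abs, Real.abs_exp,
    abs_of_nonneg (by positivity), ← Real.exp_add, ← Real.exp_add, ← Real.exp_nat_mul]
  apply Real.exp_le_exp.mpr
  push_cast
  nlinarith [sq_nonneg (‖x‖ - 2 * c)]

/-- Multiplication by `⟪ξ, q⟫`. -/
def linearPosition (ξ : Pos n) : Op n := ∑ j, (ξ j : ℂ) • position j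

theorem linearPosition_apply (ξ : Pos n) (ψ : 𝓢(Pos n, ℂ)) (x : Pos n) :
    linearPosition ξ ψ x = (inner ℝ ξ x : ℝ) * ψ x := by
  simp [linearPosition, PiLp.inner_apply, position_apply, LinearMap.sum_apply,
    _root_.sum_apply, Finset.sum_mul, mul_comm (x.ofLp _), mul_assoc]

theorem linearPosition_pow_apply (ξ : Pos n) (k : ℕ) (ψ : 𝓢(Pos n, ℂ)) (x : Pos n) :
    (linearPosition ξ ^ k) ψ x = (inner ℝ ξ x : ℝ) ^ k * ψ x := by
  induction k with
  | zero => simp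
  | succ k ih => rw [pow_succ', Module.End.mul_apply, linearPosition_apply, ih]; ring

/-- Expanding exp(i⟪ξ, x⟫) in its power series and integrating termwise against h, the product of
the vacuum with f, leaves only vanishing moments. So h = 0 almost everywhere, and the vacuum has no
zeros. -/
theorem eq_zero_of_inner_polynomial_vacuum_eq_zero (f : Hilb n)
    (hf : ∀ (ξ : Pos n) (k : ℕ), inner ℂ (toState ((linearPosition ξ ^ k) (vacuum n))) f = 0) :
    f = 0 := by
  set h : Pos n → ℂ := fun x => vacuum n x * f x with hdef
  have hexp : ∀ c : ℝ, Integrable fun x => Real.exp (c * ‖x‖) * ‖h x‖ := by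
    intro c
    have h1 := (memLp_exp_mul_norm_mul_vacuum (n := n) c).integrable_mul (Lp.memLp f).norm
    refine h1.congr (Filter.Eventually.of_forall fun x => ?_)
    simp only [hdef, vacuum_apply, Pi.mul_apply, norm_mul, Complex.norm_real, Real.norm_eq_abs,
      Real.abs_exp, mul_assoc]
  have hmeas : AEStronglyMeasurable h volume :=
    (vacuum n).continuous.aestronglyMeasurable.mul (Lp.memLp f).aestronglyMeasurable
  have hint : Integrable h := by
    rw [← integrable_norm_iff hmeas]
    simpa using hexp 0
  have hmom : ∀ (ξ : Pos n) (k : ℕ), ∫ x, ((inner ℝ ξ x : ℝ) : ℂ) ^ k * h x = 0 := by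
    intro ξ k
    rw [← hf ξ k, L2.inner_def]
    apply integral_congr_ae
    filter_upwards [((linearPosition ξ ^ k) (vacuum n)).coeFn_toLp 2 volume] with x hx
    rw [toState, hx, linearPosition_pow_apply, RCLike.inner_apply, map_mul, map_pow,
      Complex.conj_ofReal, vacuum_apply, Complex.conj_ofReal, hdef]
    simp only [vacuum_apply]
    ring
  have hzero : h =ᵐ[volume] 0 := by
    refine ae_eq_zero_of_forall_integral_exp_eq_zero hint fun ξ => ?_
    have hs := hasSum_integral_of_dominated_convergence (μ := (volume : Measure (Pos n)))
      (F := fun (k : ℕ) x => (I * (inner ℝ ξ x : ℝ)) ^ k / (k.factorial : ℂ) * h x)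
      (f := fun x => Complex.exp (I * (inner ℝ ξ x : ℝ)) * h x)
      -- These bounds sum over k to exp(‖ξ‖‖x‖)‖h x‖, integrable by `hexp`.
      (fun k x => (‖ξ‖ * ‖x‖) ^ k / (k.factorial : ℝ) * ‖h x‖)
      (fun k => by
        refine AEStronglyMeasurable.mul ?_ hmeas
        exact (by fun_prop : Continuous fun x : Pos n =>
          (I * (inner ℝ ξ x : ℝ)) ^ k / (k.factorial : ℂ)).aestronglyMeasurable)
      (fun k => Filter.Eventually.of_forall fun x => by
        rw [norm_mul, norm_div, norm_pow, norm_mul, norm_I, one_mul, Complex.norm_real,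
          Complex.norm_natCast]
        gcongr
        exact norm_inner_le_norm ξ x)
      (Filter.Eventually.of_forall fun x =>
        (Real.summable_pow_div_factorial (‖ξ‖ * ‖x‖)).mul_right _)
      (by
        refine (hexp ‖ξ‖).congr (Filter.Eventually.of_forall fun x => ?_)
        simp only [tsum_mul_right, Real.exp_eq_exp_ℝ, NormedSpace.exp_eq_tsum_div])
      (Filter.Eventually.of_forall fun x => by
        rw [Complex.exp_eq_exp_ℂ]
        exact (NormedSpace.expSeries_div_hasSum_exp (I * ((inner ℝ ξ x : ℝ) : ℂ))).mul_right _)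
    have hz : ∀ k : ℕ, ∫ x, (I * (inner ℝ ξ x : ℝ)) ^ k / (k.factorial : ℂ) * h x = 0 := by
      intro k
      have : ∀ x, (I * (inner ℝ ξ x : ℝ)) ^ k / (k.factorial : ℂ) * h x =
          (I ^ k / (k.factorial : ℂ)) * (((inner ℝ ξ x : ℝ) : ℂ) ^ k * h x) := by
        intro x
        rw [mul_pow]
        ring
      simp only [this]
      rw [integral_const_mul, hmom, mul_zero]
    simp only [hz] at hs
    exact hs.unique hasSum_zero
  rw [Lp.eq_zero_iff_ae_eq_zero]
  filter_upwards [hzero] with x hx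
  have : vacuum n x ≠ 0 := by
    rw [vacuum_apply]
    exact_mod_cast (Real.exp_pos _).ne'
  simpa [hdef, this] using hx

/-! ### Photon-number levels and the joint eigenbasis. -/

/-- The wavefunctions of total photon number `m`. -/
def photonLevel (n : ℕ) : ℕ → Submodule ℂ 𝓢(Pos n, ℂ)
  | 0 => Submodule.span ℂ {vacuum n}
  | m + 1 => ⨆ i : Fin n, (photonLevel n m).map (creat i)

instance finiteDimensional_photonLevel (m : ℕ) : FiniteDimensional ℂ (photonLevel n m) := by
  induction m with
  | zero =>
    change FiniteDimensional ℂ (Submodule.span ℂ {vacuum n})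
    infer_instance
  | succ m ih =>
    change FiniteDimensional ℂ (⨆ i : Fin n, (photonLevel n m).map (creat i) : Submodule ℂ _)
    infer_instance

theorem creat_mem_photonLevel (i : Fin n) {m : ℕ} {ψ : 𝓢(Pos n, ℂ)} (h : ψ ∈ photonLevel n m) :
    creat i ψ ∈ photonLevel n (m + 1) :=
  Submodule.mem_iSup_of_mem i (Submodule.mem_map_of_mem h)

/-- To map one level into a subspace it suffices to do so on the generators. -/
theorem photonLevel_succ_le_comap {m : ℕ} (A : Op n) (S : Submodule ℂ 𝓢(Pos n, ℂ))
    (h : ∀ (k : Fin n), ∀ χ ∈ photonLevel n m, A (creat k χ) ∈ S) :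
    photonLevel n (m + 1) ≤ S.comap A := by
  refine iSup_le fun k => ?_
  rintro _ ⟨χ, hχ, rfl⟩
  exact h k χ hχ

theorem photonLevel_zero_le_comap (A : Op n) (S : Submodule ℂ 𝓢(Pos n, ℂ))
    (h : A (vacuum n) ∈ S) : photonLevel n 0 ≤ S.comap A := by
  change Submodule.span ℂ {vacuum n} ≤ _
  rw [Submodule.span_singleton_le_iff_mem]
  exact h

/-- Induction by moving the annihilator past the outermost creator. Working with the product, rather
than with the annihilator alone, stays within one level and avoids a level below 0. -/
theorem creat_annih_mem_photonLevel (m : ℕ) :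
    ∀ i j : Fin n, ∀ ψ ∈ photonLevel n m, creat i (annih j ψ) ∈ photonLevel n m := by
  induction m with
  | zero =>
    intro i j
    change photonLevel n 0 ≤ (photonLevel n 0).comap (creat i * annih j)
    refine photonLevel_zero_le_comap (creat i * annih j) _ ?_
    simp [annih_vacuum]
  | succ m ih =>
    intro i j
    change photonLevel n (m + 1) ≤ (photonLevel n (m + 1)).comap (creat i * annih j)
    refine photonLevel_succ_le_comap (creat i * annih j) _ fun k χ hχ => ?_
    rw [Module.End.mul_apply, annih_creat, map_add, map_smul]
    exact Submodule.add_mem _ (creat_mem_photonLevel i (ih k j χ hχ))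
      (Submodule.smul_mem _ _ (creat_mem_photonLevel i hχ))

theorem annih_mem_photonLevel (j : Fin n) (m : ℕ) :
    ∀ ψ ∈ photonLevel n (m + 1), annih j ψ ∈ photonLevel n m := by
  refine photonLevel_succ_le_comap (annih j) _ fun k χ hχ => ?_
  rw [annih_creat]
  exact Submodule.add_mem _ (creat_annih_mem_photonLevel m k j χ hχ) (Submodule.smul_mem _ _ hχ)

theorem quadHamiltonian_mem_photonLevel (P : Matrix (Fin n) (Fin n) ℂ) (m : ℕ)
    {ψ : 𝓢(Pos n, ℂ)} (hψ : ψ ∈ photonLevel n m) : quadHamiltonian P ψ ∈ photonLevel n m := by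
  simp only [quadHamiltonian, LinearMap.sum_apply, LinearMap.smul_apply, Module.End.mul_apply]
  exact Submodule.sum_mem _ fun i _ => Submodule.sum_mem _ fun j _ =>
    Submodule.smul_mem _ _ (creat_annih_mem_photonLevel m i j ψ hψ)

theorem totalNumber_creat (k : Fin n) (ψ : 𝓢(Pos n, ℂ)) :
    totalNumber n (creat k ψ) = creat k (totalNumber n ψ + ψ) := by
  simp only [totalNumber, LinearMap.sum_apply, Module.End.mul_apply, annih_creat, map_add,
    map_smul, Finset.sum_add_distrib, map_sum, creat_comm k]
  simp

theorem totalNumber_of_mem_photonLevel (m : ℕ) :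
    ∀ ψ ∈ photonLevel n m, totalNumber n ψ = (m : ℂ) • ψ := by
  induction m with
  | zero =>
    intro ψ hψ
    obtain ⟨c, rfl⟩ := Submodule.mem_span_singleton.mp hψ
    simp [totalNumber, LinearMap.sum_apply, annih_vacuum]
  | succ m ih =>
    have h : photonLevel n (m + 1) ≤
        (⊥ : Submodule ℂ 𝓢(Pos n, ℂ)).comap (totalNumber n - ((m + 1 : ℕ) : ℂ) • 1) := by
      refine photonLevel_succ_le_comap _ _ fun k χ hχ => ?_
      rw [Submodule.mem_bot, LinearMap.sub_apply, totalNumber_creat, ih χ hχ]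
      simp only [LinearMap.smul_apply, Module.End.one_apply, map_add, map_smul]
      push_cast
      module
    intro ψ hψ
    have := h hψ
    rw [Submodule.mem_comap, Submodule.mem_bot, LinearMap.sub_apply, sub_eq_zero] at this
    exact this

theorem position_mem_iSup_photonLevel (j : Fin n) {ψ : 𝓢(Pos n, ℂ)}
    (hψ : ψ ∈ ⨆ m, photonLevel n m) : position j ψ ∈ ⨆ m, photonLevel n m := by
  have h : ⨆ m, photonLevel n m ≤ (⨆ m, photonLevel n m).comap (position j) := by
    refine iSup_le fun m χ hχ => ?_
    rw [Submodule.mem_comap, position_eq_creat_add_annih]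
    refine Submodule.smul_mem _ _ (Submodule.add_mem _
      (Submodule.mem_iSup_of_mem (m + 1) (creat_mem_photonLevel j hχ)) ?_)
    cases m with
    | zero =>
      obtain ⟨c, rfl⟩ := Submodule.mem_span_singleton.mp hχ
      simp [annih_vacuum]
    | succ m => exact Submodule.mem_iSup_of_mem m (annih_mem_photonLevel j m χ hχ)
  exact h hψ

theorem linearPosition_pow_vacuum_mem (ξ : Pos n) (k : ℕ) :
    (linearPosition ξ ^ k) (vacuum n) ∈ ⨆ m, photonLevel n m := by
  induction k with
  | zero => exact Submodule.mem_iSup_of_mem 0 (Submodule.mem_span_singleton_self _)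
  | succ k ih =>
    rw [pow_succ', Module.End.mul_apply, linearPosition, LinearMap.sum_apply]
    exact Submodule.sum_mem _ fun j _ =>
      Submodule.smul_mem _ _ (position_mem_iSup_photonLevel j ih)

/-- The states of total photon number `m`. -/
def photonSpace (n m : ℕ) : Submodule ℂ (Hilb n) := (photonLevel n m).map (toStateₗ n)

instance finiteDimensional_photonSpace (m : ℕ) : FiniteDimensional ℂ (photonSpace n m) := by
  unfold photonSpace; infer_instance

/-- Position is a combination of creation and annihilation, so the span of the levels contains all
powers of linear forms times the vacuum, and these are total. -/
theorem orthogonal_iSup_photonSpace : (⨆ m, photonSpace n m)ᗮ = ⊥ := by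
  rw [Submodule.eq_bot_iff]
  intro f hf
  refine eq_zero_of_inner_polynomial_vacuum_eq_zero f fun ξ k => hf _ ?_
  have := Submodule.mem_map_of_mem (f := toStateₗ n) (linearPosition_pow_vacuum_mem ξ k)
  rwa [Submodule.map_iSup] at this

theorem isSymmetricOp_totalNumber : IsSymmetricOp (totalNumber n) := by
  rw [← quadHamiltonian_one]
  exact isSymmetricOp_quadHamiltonian Matrix.isHermitian_one

/-- Different levels are eigenspaces of the symmetric total number operator for different
eigenvalues. -/
theorem orthogonalFamily_photonSpace :
    OrthogonalFamily ℂ (fun m => photonSpace n m) fun m => (photonSpace n m).subtypeₗᵢ := by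
  rintro l m hlm ⟨_, ψ, hψ, rfl⟩ ⟨_, χ, hχ, rfl⟩
  change inner ℂ (toState ψ) (toState χ) = 0
  have h := isSymmetricOp_totalNumber ψ χ
  rw [totalNumber_of_mem_photonLevel l ψ hψ, totalNumber_of_mem_photonLevel m χ hχ,
    toState_smul, toState_smul, inner_smul_left, inner_smul_right, Complex.conj_natCast] at h
  have h' : ((l : ℂ) - m) * inner ℂ (toState ψ) (toState χ) = 0 := by
    rw [sub_mul, h, sub_self]
  refine (mul_eq_zero.mp h').resolve_left (sub_ne_zero.mpr ?_)
  exact_mod_cast hlm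

/-- Wavefunctions of total photon number `m` and the states they represent. -/
def photonSpaceEquiv (n m : ℕ) : photonLevel n m ≃ₗ[ℂ] photonSpace n m :=
  Submodule.equivMapOfInjective (toStateₗ n) toState_injective (photonLevel n m)

theorem coe_photonSpaceEquiv (m : ℕ) (ψ : photonLevel n m) :
    (photonSpaceEquiv n m ψ : Hilb n) = toState (ψ : 𝓢(Pos n, ℂ)) := rfl

/-- The restriction of a compact quadratic Hamiltonian to the states of total photon number `m`. -/
def photonSpaceHamiltonian (P : Matrix (Fin n) (Fin n) ℂ) (m : ℕ) :
    photonSpace n m →ₗ[ℂ] photonSpace n m :=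
  (photonSpaceEquiv n m).conj
    ((quadHamiltonian P).restrict fun _ hψ => quadHamiltonian_mem_photonLevel P m hψ)

theorem photonSpaceHamiltonian_equiv (P : Matrix (Fin n) (Fin n) ℂ) (m : ℕ)
    (ψ : photonLevel n m) :
    (photonSpaceHamiltonian P m (photonSpaceEquiv n m ψ) : Hilb n) =
      toState (quadHamiltonian P ψ) := by
  simp [photonSpaceHamiltonian, LinearEquiv.conj_apply, coe_photonSpaceEquiv]

theorem isSymmetric_photonSpaceHamiltonian {P : Matrix (Fin n) (Fin n) ℂ} (hP : P.IsHermitian)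
    (m : ℕ) : (photonSpaceHamiltonian P m).IsSymmetric := by
  intro x y
  obtain ⟨ψ, rfl⟩ := (photonSpaceEquiv n m).surjective x
  obtain ⟨χ, rfl⟩ := (photonSpaceEquiv n m).surjective y
  rw [Submodule.coe_inner, Submodule.coe_inner, photonSpaceHamiltonian_equiv,
    photonSpaceHamiltonian_equiv, coe_photonSpaceEquiv, coe_photonSpaceEquiv]
  exact isSymmetricOp_quadHamiltonian hP ψ χ

/-- A compact quadratic Hamiltonian has a complete orthonormal system of eigenstates of definite
total photon number, given by Schwartz wavefunctions. -/
theorem exists_eigenbasis {P : Matrix (Fin n) (Fin n) ℂ} (hP : P.IsHermitian) :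
    ∃ (ι : Type) (b : HilbertBasis ι ℂ (Hilb n)) (e : ι → 𝓢(Pos n, ℂ)) (lam μ : ι → ℝ),
      (∀ k, toState (e k) = b k) ∧ (∀ k, quadHamiltonian P (e k) = (lam k : ℂ) • e k) ∧
      ∀ k, totalNumber n (e k) = (μ k : ℂ) • e k := by
  have hT := isSymmetric_photonSpaceHamiltonian hP
  -- The finite-dimensional spectral theorem, applied level by level.
  let B := fun m => (hT m).eigenvectorBasis rfl
  have hon := (orthogonalFamily_photonSpace (n := n)).orthonormal_sigma_orthonormal
    (fun m => (B m).orthonormal)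
  let e : (Σ m : ℕ, Fin (Module.finrank ℂ (photonSpace n m))) → 𝓢(Pos n, ℂ) :=
    fun k => ((photonSpaceEquiv n k.1).symm (B k.1 k.2) : 𝓢(Pos n, ℂ))
  have he : ∀ k, toState (e k) = (B k.1 k.2 : Hilb n) := by
    intro k
    rw [← coe_photonSpaceEquiv, LinearEquiv.apply_symm_apply]
  let b : HilbertBasis (Σ m : ℕ, Fin (Module.finrank ℂ (photonSpace n m))) ℂ (Hilb n) :=
    HilbertBasis.mkOfOrthogonalEqBot hon (by
      rw [eq_bot_iff, ← orthogonal_iSup_photonSpace]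
      refine Submodule.orthogonal_le (iSup_le fun m => ?_)
      intro x hx
      have h1 : (⟨x, hx⟩ : photonSpace n m) ∈ Submodule.span ℂ (Set.range (B m)) := by
        rw [← (B m).coe_toBasis, (B m).toBasis.span_eq]
        trivial
      have h2 := Submodule.mem_map_of_mem (f := (photonSpace n m).subtype) h1
      rw [Submodule.map_span] at h2
      refine Submodule.span_mono ?_ h2
      rintro _ ⟨_, ⟨i, rfl⟩, rfl⟩
      exact ⟨⟨m, i⟩, rfl⟩)
  refine ⟨_, b, e, fun k => (hT k.1).eigenvalues rfl k.2, fun k => k.1, fun k => ?_, fun k => ?_,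
    fun k => ?_⟩
  · rw [he]
    simp [b, HilbertBasis.coe_mkOfOrthogonalEqBot]
  -- The eigenvalue equation is known for states and is pulled back to Schwartz wavefunctions.
  · apply toState_injective
    have h1 := (hT k.1).apply_eigenvectorBasis rfl k.2
    have h2 := photonSpaceHamiltonian_equiv P k.1 ((photonSpaceEquiv n k.1).symm (B k.1 k.2))
    rw [LinearEquiv.apply_symm_apply, h1] at h2
    rw [toState_smul, he, ← h2]
    rfl
  · simpa using totalNumber_of_mem_photonLevel k.1 (e k)
      ((photonSpaceEquiv n k.1).symm (B k.1 k.2)).2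

/-! ### Schwinger combinations as Hermitian quadratic Hamiltonians. -/

theorem quadHamiltonian_add (P Q : Matrix (Fin n) (Fin n) ℂ) :
    quadHamiltonian (P + Q) = quadHamiltonian P + quadHamiltonian Q := by
  simp [quadHamiltonian, add_smul, Finset.sum_add_distrib]

theorem quadHamiltonian_smul (c : ℂ) (P : Matrix (Fin n) (Fin n) ℂ) :
    quadHamiltonian (c • P) = c • quadHamiltonian P := by
  simp [quadHamiltonian, Finset.smul_sum, smul_smul]

theorem quadHamiltonian_sum {ι : Type*} (s : Finset ι) (P : ι → Matrix (Fin n) (Fin n) ℂ) :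
    quadHamiltonian (∑ k ∈ s, P k) = ∑ k ∈ s, quadHamiltonian (P k) := by
  classical
  induction s using Finset.induction_on with
  | empty => simp [quadHamiltonian]
  | insert a s ha ih => rw [Finset.sum_insert ha, Finset.sum_insert ha, quadHamiltonian_add, ih]

theorem quadHamiltonian_single (r s : Fin n) (c : ℂ) :
    quadHamiltonian (Matrix.single r s c) = c • (creat r * annih s) := by
  simp [quadHamiltonian, Matrix.single_apply, ite_and, ite_smul]

theorem exists_isHermitian_schwinger (r s : Fin n) (a : Axis) :
    ∃ P : Matrix (Fin n) (Fin n) ℂ, P.IsHermitian ∧ schwinger r s a = quadHamiltonian P := by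
  cases a with
  | zero =>
    refine ⟨Matrix.single r r (1 / 2) + Matrix.single s s (1 / 2), ?_, ?_⟩
    · simp [Matrix.IsHermitian, Matrix.conjTranspose_single]
    · simp only [schwinger, quadHamiltonian_add, quadHamiltonian_single]
      module
  | x =>
    refine ⟨Matrix.single r s (1 / 2) + Matrix.single s r (1 / 2), ?_, ?_⟩
    · simp [Matrix.IsHermitian, Matrix.conjTranspose_single, add_comm]
    · simp only [schwinger, quadHamiltonian_add, quadHamiltonian_single]
      module
  | y =>
    -- The coefficient 1/(2i) is imaginary, so its negative is its conjugate, as Hermiticity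
    -- demands.
    refine ⟨Matrix.single r s (1 / (2 * I)) + Matrix.single s r (-(1 / (2 * I))), ?_, ?_⟩
    · simp [Matrix.IsHermitian, Matrix.conjTranspose_single, add_comm]
    · simp only [schwinger, quadHamiltonian_add, quadHamiltonian_single]
      module
  | z =>
    refine ⟨Matrix.single r r (1 / 2) + Matrix.single s s (-(1 / 2)), ?_, ?_⟩
    · simp [Matrix.IsHermitian, Matrix.conjTranspose_single]
    · simp only [schwinger, quadHamiltonian_add, quadHamiltonian_single]
      module

theorem isHermitian_ofReal_smul {P : Matrix (Fin n) (Fin n) ℂ} (hP : P.IsHermitian) (c : ℝ) :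
    ((c : ℂ) • P).IsHermitian := by
  rw [Matrix.IsHermitian, Matrix.conjTranspose_smul, hP.eq]
  simp

theorem isHermitian_sum {ι : Type*} [Fintype ι] (P : ι → Matrix (Fin n) (Fin n) ℂ)
    (hP : ∀ k, (P k).IsHermitian) : (∑ k, P k).IsHermitian := by
  rw [Matrix.IsHermitian, Matrix.conjTranspose_sum]
  exact Finset.sum_congr rfl fun k _ => hP k

theorem IsSchwingerCombination.exists_isHermitian {N : Op n} (hN : IsSchwingerCombination N) :
    ∃ P : Matrix (Fin n) (Fin n) ℂ, P.IsHermitian ∧ N = quadHamiltonian P := by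
  obtain ⟨c, rfl⟩ := hN
  choose P hP hS using fun r s => exists_isHermitian_schwinger (n := n) r s
  refine ⟨∑ r, ∑ s, (((c r s Axis.zero : ℝ) : ℂ) • P r s Axis.zero
      + ((c r s Axis.x : ℝ) : ℂ) • P r s Axis.x
      + ((c r s Axis.y : ℝ) : ℂ) • P r s Axis.y
      + ((c r s Axis.z : ℝ) : ℂ) • P r s Axis.z), ?_, ?_⟩
  · refine isHermitian_sum _ fun r => isHermitian_sum _ fun s => ?_
    exact (((isHermitian_ofReal_smul (hP r s _) _).add (isHermitian_ofReal_smul (hP r s _) _)).add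
      (isHermitian_ofReal_smul (hP r s _) _)).add (isHermitian_ofReal_smul (hP r s _) _)
  · simp only [quadHamiltonian_sum, quadHamiltonian_add, quadHamiltonian_smul, hS]

end Qumode

end

theorem theorem1 (n : ℕ) (K : Matrix (Fin n) (Fin n) ℂ) (φ : Qumode.Hilb n)
    (hφ : Qumode.IsGaussianPureState K φ) (N : Qumode.Op n)
    (hN : Qumode.IsSchwingerNullifier N φ) :
    ∃ U : ℝ → Qumode.Hilb n →L[ℂ] Qumode.Hilb n,
      Qumode.IsExpGroup N U ∧
      (∀ U' : ℝ → Qumode.Hilb n →L[ℂ] Qumode.Hilb n, Qumode.IsExpGroup N U' → U' = U) ∧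
      ∀ θ : ℝ, Qumode.IsPassiveInterferometric (U θ) ∧
        Qumode.ConservesPhotonNumber (U θ) ∧
        U θ φ = φ := by
  obtain ⟨hS, ψ, rfl, hψ⟩ := hN
  obtain ⟨P, hP, rfl⟩ := hS.exists_isHermitian
  obtain ⟨ι, b, e, lam, μ, he, hlam, hμ⟩ := Qumode.exists_eigenbasis hP
  have hU := Qumode.isExpGroup_expGroup (Qumode.isSymmetricOp_quadHamiltonian hP) b e he lam hlam
  refine ⟨b.expGroup lam, hU, fun U' hU' => hU.unique_of_eigenbasis hU' b e he lam hlam,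
    fun θ => ⟨?_, ?_, ?_⟩⟩
  · have hθ := Qumode.isHermitian_ofReal_smul hP θ
    -- Time θ of the group of `P` is time 1 of the group of `θ • P`: the same eigenbasis with
    -- eigenvalues scaled by θ.
    refine ⟨(θ : ℂ) • P, hθ, b.expGroup fun k => θ * lam k,
      Qumode.isExpGroup_expGroup (Qumode.isSymmetricOp_quadHamiltonian hθ) b e he _ fun k => ?_, ?_⟩
    · rw [Qumode.quadHamiltonian_smul, LinearMap.smul_apply, hlam, smul_smul]
      push_cast
      rfl
    · ext1 f
      refine b.ext_repr fun k => ?_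
      rw [HilbertBasis.repr_expGroup, HilbertBasis.repr_expGroup]
      push_cast
      rw [one_mul]
  · intro f g hfg
    -- The closed number operator is diagonal in the same basis, so the phases commute with its
    -- eigenvalues `μ k`.
    rw [Qumode.closedGraph_eq_of_eigenbasis Qumode.isSymmetricOp_totalNumber b e he μ hμ] at hfg ⊢
    intro k
    have hk : b.repr g k = μ k * b.repr f k := hfg k
    simp only [HilbertBasis.repr_expGroup, hk]
    ring
  -- A nullified state is an eigenvector with eigenvalue 0, so its phase is 1 at all times.
  · have h0 : Qumode.quadHamiltonian P ψ = ((0 : ℝ) : ℂ) • ψ := by simpa using hψ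
    rw [hU.apply_eigenvector h0 θ]
    simp
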